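/- Let $\mathsf{BorelStoch}$ be the Markov category of standard Borel spaces and Markov kernels. In a Markov category, for $p\colon A\to X$ and $f,g\colon W\otimes X\to Y$, write $f=_{p\text{-a.s.}}g$ if $$(f\otimes \mathrm{id}_X)\circ(\mathrm{id}_W\otimes(\mathrm{copy}_X\circ p))=(g\otimes \mathrm{id}_X)\circ(\mathrm{id}_W\otimes(\mathrm{copy}_X\circ p)).$$ For $p\colon A\to X$ and $q\colon B\to X$, write $p\ll q$ if, for all objects $W,Y$ and all $f,g\colon W\otimes X\to Y$, $f=_{q\text{-a.s.}}g$ implies $f=_{p\text{-a.s.}}g$. A *support* of $p\colon A\to X$ is an object $S$ with bijections $\mathrm{Hom}(Z,S)\cong\{f\colon Z\to X \mid f\ll p\}$, natural in $Z$, that restrict to bijections between the deterministic morphisms on the two sides. The morphism $p$ is *atomic* if $\mathrm{copy}_X\circ p\ll p\otimes p$. **Theorem.** Let $p\colon A\to X$ be a morphism in $\mathsf{BorelStoch}$. Its set of atoms $$\mathrm{At}(p)=\{x\in X \mid \exists a\in A,\ p(\{x\}|a)>0\}$$ is universally measurable, i.e. measurable for the completion of every probability measure on $X$. Consider the following conditions: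 1. $p$ has a support. 2. There is a smallest measurable set $S\subseteq X$ with $p(S|a)=1$ for all $a\in A$. 3. $p$ is atomic. 4. $p(\mathrm{At}(p)|a)=1$ for all $a\in A$. Then $(1)\Leftrightarrow(2)\Rightarrow(3)\Leftrightarrow(4)$. If $A$ is at most countable, then also $(3)\Rightarrow(2)$. This converse fails in general: every measurable map $f\colon A\to X$ between standard Borel spaces whose image is not measurable, considered as the morphism $a\mapsto\delta_{f(a)}$, satisfies $(3)$ but not $(2)$, and such maps exist, already from $\mathbb{R}$ to $\mathbb{R}$. -/

import Mathlib

open CategoryTheory MonoidalCategory ComonObj MeasureTheory ProbabilityTheory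

universe v u

/-! ### Almost sure equality, absolute continuity, supports in a Markov category -/

namespace MarkovSupp

variable {C : Type u} [Category.{v} C] [MonoidalCategory C] [MarkovCategory C]

/-- For `p : A ⟶ X`, the operation sending `f : W ⊗ X ⟶ Y` to the morphism `W ⊗ A ⟶ Y ⊗ X` that
runs `p`, copies its result, and feeds one of the two copies (together with `W`) into `f`. -/
def copyRun {A X W Y : C} (p : A ⟶ X) (f : W ⊗ X ⟶ Y) : W ⊗ A ⟶ Y ⊗ X :=
  (W ◁ (p ≫ Δ[X])) ≫ (α_ W X X).inv ≫ (f ▷ X)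

/-- `f` and `g` are `p`-almost surely equal (with an extra input `W`). -/
def ASEq {A X W Y : C} (p : A ⟶ X) (f g : W ⊗ X ⟶ Y) : Prop :=
  copyRun p f = copyRun p g

/-- `p ≪ q`: for all `W` and `Y`, `q`-almost sure equality of morphisms `W ⊗ X ⟶ Y` implies
`p`-almost sure equality. -/
def AbsCont {A B X : C} (p : A ⟶ X) (q : B ⟶ X) : Prop :=
  ∀ ⦃W Y : C⦄ (f g : W ⊗ X ⟶ Y), ASEq q f g → ASEq p f g

/-- A support for `p : A ⟶ X`: an object `S` together with a bijection, natural in `Z`, between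
morphisms `Z ⟶ S` and morphisms `Z ⟶ X` that are absolutely continuous with respect to `p`,
which restricts to a bijection between the deterministic morphisms on the two sides. -/
structure Support {A X : C} (p : A ⟶ X) where
  /-- The supporting object. -/
  S : C
  /-- The representing bijection. -/
  homEquiv : ∀ Z : C, (Z ⟶ S) ≃ {f : Z ⟶ X // AbsCont f p}
  naturality : ∀ {Z Z' : C} (h : Z' ⟶ Z) (k : Z ⟶ S),
    (homEquiv Z' (h ≫ k)).1 = h ≫ (homEquiv Z k).1
  deterministic_iff : ∀ {Z : C} (k : Z ⟶ S),
    Deterministic k ↔ Deterministic (homEquiv Z k).1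

/-- `p` has a support. -/
def HasSupport {A X : C} (p : A ⟶ X) : Prop := Nonempty (Support p)

/-- `p` is atomic: `copy ∘ p ≪ p ⊗ p`. -/
def IsAtomic {A X : C} (p : A ⟶ X) : Prop := AbsCont (p ≫ Δ[X]) (p ⊗ₘ p)

end MarkovSupp

/-! ### The Markov category of standard Borel spaces and Markov kernels -/

/-- The measurable spaces that are standard Borel, as a property of objects of `Stoch`. -/
def isBorel : ObjectProperty Stoch.{u} := fun X => StandardBorelSpace X.obj

instance : isBorel.{u}.IsMonoidal where
  prop_unit := inferInstanceAs (StandardBorelSpace PUnit)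
  prop_tensor X Y hX hY := by
    have : StandardBorelSpace X.obj := hX
    have : StandardBorelSpace Y.obj := hY
    exact inferInstanceAs (StandardBorelSpace (X.obj × Y.obj))

/-- `BorelStoch`: the full subcategory of `Stoch` (measurable spaces and Markov kernels) on the
standard Borel spaces. -/
abbrev BorelStoch := isBorel.{u}.FullSubcategory

namespace BorelStoch

/-- Copying and discarding are inherited from `Stoch`. -/
noncomputable instance (X : BorelStoch.{u}) : ComonObj X where
  counit := ObjectProperty.homMk ε[X.obj]
  comul := ObjectProperty.homMk Δ[X.obj]
  counit_comul := by
    ext : 1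
    exact ComonObj.counit_comul X.obj
  comul_counit := by
    ext : 1
    exact ComonObj.comul_counit X.obj
  comul_assoc := by
    ext : 1
    exact ComonObj.comul_assoc X.obj

noncomputable instance : MarkovCategory BorelStoch.{u} where
  isCommComonObj X := ⟨by ext : 1; exact IsCommComonObj.comul_comm X.obj⟩
  copy_tensor X Y := by
    ext : 1
    exact CopyDiscardCategory.copy_tensor X.obj Y.obj
  discard_tensor X Y := by
    ext : 1
    exact CopyDiscardCategory.discard_tensor X.obj Y.obj
  copy_unit := by
    ext : 1
    exact CopyDiscardCategory.copy_unit
  discard_unit := by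
    ext : 1
    exact CopyDiscardCategory.discard_unit
  discard_natural f := by
    ext : 1
    exact MarkovCategory.discard_natural f.hom

/-- The underlying set of a standard Borel space. -/
abbrev Pt (X : BorelStoch.{u}) : Type u := X.obj.obj

/-- A standard Borel space as an object of `BorelStoch`. -/
abbrev of (X : Type u) [MeasurableSpace X] [h : StandardBorelSpace X] : BorelStoch.{u} :=
  ⟨⟨SFinKer.of X⟩, h⟩

/-- The Markov kernel underlying a morphism; `kernel p a s` is `p(s|a)`. -/
abbrev kernel {A X : BorelStoch.{u}} (p : A ⟶ X) : Kernel A.Pt X.Pt := p.hom.hom.hom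

/-- A measurable map, considered as the morphism `a ↦ δ_{f a}`. -/
noncomputable def ofMap {A X : BorelStoch.{u}} (f : A.Pt → X.Pt) (hf : Measurable f) : A ⟶ X :=
  ObjectProperty.homMk ⟨⟨Kernel.deterministic f hf, inferInstance⟩,
    inferInstanceAs (IsMarkovKernel (Kernel.deterministic f hf))⟩

/-- The set of atoms of `p`: the points `x` with `p({x}|a) > 0` for some `a`. -/
def atoms {A X : BorelStoch.{u}} (p : A ⟶ X) : Set X.Pt := {x | ∃ a, 0 < kernel p a {x}}

/-- There is a smallest measurable set `S` with `p(S|a) = 1` for all `a`. -/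
def HasSmallestFullSet {A X : BorelStoch.{u}} (p : A ⟶ X) : Prop :=
  ∃ S : Set X.Pt, IsLeast {T : Set X.Pt | MeasurableSet T ∧ ∀ a, kernel p a T = 1} S

end BorelStoch

/-- A set is universally measurable if it is measurable with respect to the completion of every
probability measure. On such a set the value of a Mathlib measure, which is defined on all sets as
the outer extension, is the value of its completion. -/
def IsUniversallyMeasurable {X : Type u} [MeasurableSpace X] (s : Set X) : Prop :=
  ∀ (μ : Measure X) [IsProbabilityMeasure μ], NullMeasurableSet s μ

/-!
Absolute continuity in `BorelStoch` is a statement about null sets. Two morphisms `W ⊗ X ⟶ Y` are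
`q`-almost surely equal iff, for every `w` and `b`, their slices at `w` agree `q(-|b)`-almost
everywhere, because a kernel into a standard Borel space is determined almost everywhere by its
composition product with a measure. Hence `p ≪ q` iff every measurable set that is null for all
`q(-|b)` is null for all `p(-|a)` (`BorelStoch.absCont_iff`), and all conditions of the theorem
become measure theoretic.

The set of atoms is the projection of the Borel set of pairs `(a, x)` with `p({x}|a) > 0`, so it is
analytic, and analytic sets are universally measurable
(`MeasureTheory.AnalyticSet.nullMeasurableSet`). If the atoms do not have full measure for some
`p(-|a)`, then there is a Borel set `B` without atoms that has positive measure; its diagonal is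
null for all products `p(-|a₁) ⊗ p(-|a₂)` but not for `copy ∘ p`, so `p` is not atomic. Conversely,
a set that is null for all these products contains no diagonal point over an atom. Thus atomicity
says that the atoms have full measure (`BorelStoch.isAtomic_iff_apply_atoms`). Since every
measurable set of full measure contains all atoms, and a point that is not an atom can be removed
from such a set, a smallest one exists iff `p` is atomic and its set of atoms is Borel
(`BorelStoch.hasSmallestFullSet_iff`). The set of atoms is Borel when it is countable, which gives
the case of countable `A`. For `a ↦ δ_{f a}` the atoms form the range of `f`, which gives the
counterexamples once an analytic set that is not Borel is known
(`exists_analyticSet_not_measurableSet`, by diagonalizing over a universal closed set).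

A smallest full set is a support, because the morphisms `f ≪ p` are those concentrated on it.
Conversely, the identity of a support `S` corresponds to a deterministic morphism, that is, to a
measurable map `S → X`. It is injective because it is so on points, so its range is Borel by
the Lusin–Souslin theorem, and this range is the smallest full set (`BorelStoch.hasSupport_iff`).
-/

/-! ### Analytic sets -/

section Analytic

open Set

/-- If `f` is continuous, every open set containing the image of the compact box
`{σ | ∀ i, σ i ≤ n i}` already contains the image of a box with finitely many constraints. -/
theorem exists_image_finite_box_subset {X : Type*} [TopologicalSpace X] {f : (ℕ → ℕ) → X}
    (hf : Continuous f) (n : ℕ → ℕ) {U : Set X} (hU : IsOpen U)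
    (h : f '' {σ | ∀ i, σ i ≤ n i} ⊆ U) : ∃ k, f '' {σ | ∀ i < k, σ i ≤ n i} ⊆ U := by
  by_contra! hcon
  simp only [image_subset_iff, not_subset, mem_ofPred_eq, mem_preimage] at hcon
  choose σ hσ hσU using hcon
  -- truncated to the compact box, the points `σ k` have a cluster point
  have hcpt : IsCompact {τ : ℕ → ℕ | ∀ i, τ i ≤ n i} := by
    have : {τ : ℕ → ℕ | ∀ i, τ i ≤ n i} = Icc 0 n := by ext; simp [Pi.le_def]
    rw [this]
    exact isCompact_Icc
  obtain ⟨τ, hτ, φ, hφ, hlim⟩ := hcpt.tendsto_subseq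
    (x := fun k i => min (σ k i) (n i)) fun k i => min_le_right _ _
  have hlim' : Filter.Tendsto (σ ∘ φ) Filter.atTop (nhds τ) := by
    rw [tendsto_pi_nhds] at hlim ⊢
    intro i
    refine (hlim i).congr' ?_
    filter_upwards [Filter.eventually_gt_atTop i] with k hk
    exact min_eq_left (hσ _ i (hk.trans_le hφ.le_apply))
  obtain ⟨k, hk⟩ := ((hf.tendsto τ).comp hlim' |>.eventually
    (hU.mem_nhds (h ⟨τ, hτ, rfl⟩))).exists
  exact hσU _ hk

/-- Analytic sets are universally measurable. If `s` is the image of `f : (ℕ → ℕ) → X`, then bounds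
`n i` on the coordinates can be chosen one after the other such that only little outer measure is
lost altogether; by `exists_image_finite_box_subset` and outer regularity, the image of the compact
box that they define has almost the measure of `s`. -/
theorem MeasureTheory.AnalyticSet.nullMeasurableSet {X : Type*} [TopologicalSpace X] [PolishSpace X]
    [MeasurableSpace X] [BorelSpace X] {s : Set X} (hs : AnalyticSet s) (μ : Measure X)
    [IsFiniteMeasure μ] : NullMeasurableSet s μ := by
  rw [AnalyticSet] at hs
  obtain rfl | ⟨f, hf, rfl⟩ := hs
  · exact nullMeasurableSet_empty
  -- approximation from inside by compact sets
  have key (r : ENNReal) (hr : r < μ (range f)) :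
      ∃ K ⊆ range f, MeasurableSet K ∧ r ≤ μ K := by
    -- one more coordinate can be bounded without losing the strict inequality, since the outer
    -- measure is continuous along increasing unions of arbitrary sets
    have step (k : ℕ) (n : ℕ → ℕ) (h : r < μ (f '' {σ | ∀ i < k, σ i ≤ n i})) :
        ∃ m, r < μ (f '' {σ | (∀ i < k, σ i ≤ n i) ∧ σ k ≤ m}) := by
      have hU : f '' {σ | ∀ i < k, σ i ≤ n i} =
          ⋃ m, f '' {σ | (∀ i < k, σ i ≤ n i) ∧ σ k ≤ m} := by
        rw [← image_iUnion]
        congr 1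
        ext σ
        simp only [mem_ofPred_eq, mem_iUnion]
        exact ⟨fun h => ⟨σ k, h, le_rfl⟩, fun ⟨_, h, _⟩ => h⟩
      have hmono : Monotone fun m => f '' {σ | (∀ i < k, σ i ≤ n i) ∧ σ k ≤ m} :=
        fun m m' hm => image_mono fun σ hσ => ⟨hσ.1, hσ.2.trans hm⟩
      rw [hU, hmono.measure_iUnion] at h
      exact lt_iSup_iff.1 h
    choose! m hm using step
    -- the bounds `n i`, chosen one after the other
    let n : ℕ → ℕ := fun i =>
      Nat.strongRec (fun i ih => m i fun j => if h : j < i then ih j h else 0) i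
    have hn (i : ℕ) : n i = m i fun j => if j < i then n j else 0 := by
      simp only [n]
      rw [Nat.strongRec_eq]
      simp
    have hbox (k : ℕ) : r < μ (f '' {σ | ∀ i < k, σ i ≤ n i}) := by
      induction k with
      | zero => simpa using hr
      | succ k ih =>
        have hset : {σ : ℕ → ℕ | ∀ i < k, σ i ≤ n i} =
            {σ | ∀ i < k, σ i ≤ (fun j => if j < k then n j else 0) i} := by
          ext σ
          exact forall₂_congr fun i hi => by simp [hi]
        rw [hset] at ih
        refine (hm k _ ih).trans_le (measure_mono (image_mono fun σ hσ i hi => ?_))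
        rw [← hn] at hσ
        obtain hi | rfl := Nat.lt_succ_iff_lt_or_eq.1 hi
        · simpa [hi] using hσ.1 i hi
        · exact hσ.2
    have hcpt : IsCompact (f '' {σ | ∀ i, σ i ≤ n i}) := by
      have : {τ : ℕ → ℕ | ∀ i, τ i ≤ n i} = Icc 0 n := by ext; simp [Pi.le_def]
      rw [this]
      exact isCompact_Icc.image hf
    refine ⟨_, image_subset_range _ _, hcpt.measurableSet, ?_⟩
    by_contra! hlt
    obtain ⟨U, hKU, hU, hUr⟩ := exists_isOpen_lt_of_lt _ _ hlt
    obtain ⟨k, hk⟩ := exists_image_finite_box_subset hf n hU hKU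
    exact ((hbox k).trans_le (measure_mono hk)).not_gt hUr
  obtain h0 | hpos := eq_zero_or_pos (μ (range f))
  · exact NullMeasurableSet.of_null h0
  obtain ⟨r, -, hr, hlim⟩ := exists_seq_strictMono_tendsto' hpos
  choose K hK hKm hrK using fun k => key (r k) (hr k).2
  have hle : μ (range f) ≤ μ (⋃ k, K k) :=
    le_of_tendsto' hlim fun k => (hrK k).trans (measure_mono (subset_iUnion K k))
  have hm := (MeasurableSet.iUnion hKm).nullMeasurableSet (μ := μ)
  exact hm.congr (ae_eq_of_subset_of_measure_ge (iUnion_subset hK) hle hm (measure_ne_top μ _))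

/-- There is an analytic subset of Baire space that is not Borel: the set of all `c` such that `c`
lies in the projection of the closed set coded by `c`. If it were Borel, its complement would be
analytic, hence the projection of a closed set, and a code of the latter would lie in the
complement iff it does not. -/
theorem exists_analyticSet_not_measurableSet :
    ∃ s : Set (ℕ → ℕ), AnalyticSet s ∧ ¬ MeasurableSet s := by
  obtain ⟨b, hbc, -, hb⟩ := TopologicalSpace.exists_countable_basis ((ℕ → ℕ) × (ℕ → ℕ))
  -- `∅` is added to the basis so that the empty union, too, is a union over a sequence
  obtain ⟨U, hU⟩ := (hbc.insert ∅).exists_eq_range (insert_nonempty _ _)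
  have hUo (n : ℕ) : IsOpen (U n) := by
    have : U n ∈ insert ∅ b := hU ▸ mem_range_self n
    obtain h | h := this
    · rw [h]; exact isOpen_empty
    · exact hb.isOpen h
  -- the sequence `c` codes the closed set that is the complement of `⋃ n, U (c n)`
  have hF : IsClosed {z : (ℕ → ℕ) × (ℕ → ℕ) | ∀ n, z ∉ U (z.1 n)} := by
    have : {z : (ℕ → ℕ) × (ℕ → ℕ) | ∀ n, z ∉ U (z.1 n)} = (⋃ n, ⋃ m, {z | z.1 n = m} ∩ U m)ᶜ := by
      ext z
      simp
    rw [this, isClosed_compl_iff]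
    refine isOpen_iUnion fun n => isOpen_iUnion fun m => IsOpen.inter ?_ (hUo m)
    exact (isOpen_discrete ({m} : Set ℕ)).preimage
      (f := fun z : (ℕ → ℕ) × (ℕ → ℕ) => z.1 n) (by fun_prop)
  refine ⟨Prod.fst '' {z : (ℕ → ℕ) × (ℕ → ℕ) | ∀ n, z ∉ U (z.1 n)},
    hF.analyticSet.image_of_continuous continuous_fst, fun hmeas => ?_⟩
  have hcompl := hmeas.compl.analyticSet
  obtain ⟨C, hC, hCs⟩ : ∃ C : Set ((ℕ → ℕ) × (ℕ → ℕ)), IsClosed C ∧ Prod.fst '' C =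
      (Prod.fst '' {z : (ℕ → ℕ) × (ℕ → ℕ) | ∀ n, z ∉ U (z.1 n)})ᶜ := by
    rw [AnalyticSet] at hcompl
    obtain h | ⟨g, hg, hgs⟩ := hcompl
    · exact ⟨∅, isClosed_empty, by rw [h, image_empty]⟩
    · refine ⟨{z | z.1 = g z.2}, isClosed_eq continuous_fst (hg.comp continuous_snd), ?_⟩
      rw [← hgs]
      ext x
      simp [eq_comm]
  obtain ⟨c, hc⟩ : ∃ c : ℕ → ℕ, C = (⋃ n, U (c n))ᶜ := by
    obtain ⟨S, hSb, hS⟩ := hb.open_eq_sUnion hC.isOpen_compl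
    obtain ⟨c', hc'⟩ := ((hbc.mono hSb).insert ∅).exists_eq_range (insert_nonempty _ _)
    have (n : ℕ) : ∃ m, U m = c' n := by
      rw [← mem_range, ← hU]
      exact insert_subset_insert hSb (hc' ▸ mem_range_self n)
    choose c hc using this
    refine ⟨c, ?_⟩
    simp_rw [hc, ← sUnion_range, ← hc']
    rw [sUnion_insert, empty_union, ← hS, compl_compl]
  have hiff : c ∈ Prod.fst '' C ↔
      c ∈ Prod.fst '' {z : (ℕ → ℕ) × (ℕ → ℕ) | ∀ n, z ∉ U (z.1 n)} := by
    rw [hc]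
    simp
  rw [hCs] at hiff
  exact not_iff_self hiff

/-- A continuous parametrization of a non-Borel analytic set, transported along a Borel isomorphism
between the real line and Baire space. -/
theorem exists_measurable_range_not_measurableSet :
    ∃ f : ℝ → ℝ, Measurable f ∧ ¬ MeasurableSet (range f) := by
  obtain ⟨s, hs, hns⟩ := exists_analyticSet_not_measurableSet
  rw [AnalyticSet] at hs
  obtain rfl | ⟨g, hg, rfl⟩ := hs
  · exact absurd MeasurableSet.empty hns
  have hN : ¬ Countable (ℕ → ℕ) := fun _ => hns (to_countable _).measurableSet
  let e : ℝ ≃ᵐ (ℕ → ℕ) :=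
    PolishSpace.measurableEquivOfNotCountable (by rw [not_countable_iff]; infer_instance) hN
  refine ⟨e.symm ∘ g ∘ e, e.symm.measurable.comp (hg.measurable.comp e.measurable), fun h => hns ?_⟩
  rw [range_comp, e.surjective.range_comp] at h
  exact e.symm.measurableEmbedding.measurableSet_image.1 h

end Analytic

/-! ### Kernels -/

/-- Two finite measures on a countably generated space agree as soon as they agree on a countable
algebra of sets, so that agreement of two kernels is a measurable condition. -/
theorem measurableSet_eq_kernel {α β : Type*} [MeasurableSpace α] [MeasurableSpace β]
    [MeasurableSpace.CountablyGenerated β] (κ η : Kernel α β) [IsFiniteKernel κ]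
    [IsFiniteKernel η] : MeasurableSet {a | κ a = η a} := by
  let C := generateSetAlgebra (MeasurableSpace.countableGeneratingSet β)
  have hC : IsSetAlgebra C := isSetAlgebra_generateSetAlgebra
  have hgen : MeasurableSpace.generateFrom C = ‹MeasurableSpace β› := by
    rw [generateFrom_generateSetAlgebra_eq,
      MeasurableSpace.generateFrom_countableGeneratingSet]
  have hmeas (s : Set β) (hs : s ∈ C) : MeasurableSet s := by
    rw [← hgen]
    exact MeasurableSpace.measurableSet_generateFrom hs
  have heq : {a | κ a = η a} = ⋂ s ∈ C, {a | κ a s = η a s} := by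
    ext a
    simp only [Set.mem_ofPred_eq, Set.mem_iInter]
    exact ⟨fun h s _ => by rw [h], fun h => ext_of_generate_finite C hgen.symm
      (fun s hs t ht _ => hC.inter_mem hs ht) h (h _ hC.univ_mem)⟩
  rw [heq]
  exact MeasurableSet.biInter (countable_generateSetAlgebra
      MeasurableSpace.countable_countableGeneratingSet)
    fun s hs => measurableSet_eq_fun (κ.measurable_coe (hmeas s hs)) (η.measurable_coe (hmeas s hs))

theorem isDeterministic_map_iff {α β γ : Type*} [MeasurableSpace α] [MeasurableSpace β]
    [MeasurableSpace γ] {f : β → γ} (hf : MeasurableEmbedding f) (κ : Kernel α β)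
    [IsFiniteKernel κ] : IsDeterministic (κ.map f) ↔ IsDeterministic κ := by
  rw [Kernel.isDeterministic_iff_isZeroOneMeasure, Kernel.isDeterministic_iff_isZeroOneMeasure]
  refine forall_congr' fun a => ⟨fun h => ⟨fun s hs => ?_⟩, fun h => ⟨fun s hs => ?_⟩⟩
  · have := h.zero_one₀ (hf.measurableSet_image' hs)
    rwa [Kernel.map_apply _ hf.measurable, hf.map_apply,
      Set.preimage_image_eq _ hf.injective] at this
  · rw [Kernel.map_apply _ hf.measurable, hf.map_apply]
    exact h.zero_one₀ (hf.measurable hs)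

namespace BorelStoch

/-! ### The kernels underlying the structure of `BorelStoch` -/

variable {A B X Y Z W : BorelStoch.{u}}

instance (X : BorelStoch.{u}) : StandardBorelSpace X.Pt := X.property

instance isMarkovKernel_kernel (p : A ⟶ X) : IsMarkovKernel (kernel p) := p.hom.property

theorem kernel_injective : Function.Injective (kernel : (A ⟶ X) → Kernel A.Pt X.Pt) := by
  intro p q h
  ext : 3
  exact h

/-- A Markov kernel between standard Borel spaces, as a morphism of `BorelStoch`. -/
noncomputable def ofKernel (κ : Kernel A.Pt X.Pt) [IsMarkovKernel κ] : A ⟶ X :=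
  ObjectProperty.homMk ⟨⟨κ, inferInstance⟩, ‹_›⟩

theorem kernel_ofKernel (κ : Kernel A.Pt X.Pt) [IsMarkovKernel κ] : kernel (ofKernel κ) = κ := rfl

theorem kernel_ofMap (f : A.Pt → X.Pt) (hf : Measurable f) :
    kernel (ofMap f hf) = Kernel.deterministic f hf := rfl

theorem kernel_comp (p : A ⟶ X) (q : X ⟶ Y) : kernel (p ≫ q) = kernel q ∘ₖ kernel p := rfl

theorem kernel_whiskerLeft (W : BorelStoch.{u}) (p : A ⟶ X) :
    kernel (W ◁ p) = Kernel.id ∥ₖ kernel p := rfl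

theorem kernel_whiskerRight (p : A ⟶ X) (W : BorelStoch.{u}) :
    kernel (p ▷ W) = kernel p ∥ₖ Kernel.id := rfl

theorem kernel_copy : kernel Δ[X] = Kernel.copy X.Pt := rfl

theorem kernel_associator_inv : kernel (α_ W X Y).inv =
    Kernel.deterministic (MeasurableEquiv.prodAssoc (α := W.Pt) (β := X.Pt) (γ := Y.Pt)).symm
      (MeasurableEquiv.measurable _) := rfl

theorem kernel_tensorHom (p : A ⟶ X) (q : B ⟶ Y) : kernel (p ⊗ₘ q) = kernel p ∥ₖ kernel q := by
  rw [MonoidalCategory.tensorHom_def, kernel_comp, kernel_whiskerLeft, kernel_whiskerRight,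
    Kernel.id_parallelComp_comp_parallelComp_id]

theorem deterministic_iff (p : A ⟶ X) : Deterministic p ↔ IsDeterministic (kernel p) := by
  constructor
  · intro h
    exact ⟨by rw [← kernel_copy, ← kernel_copy, ← kernel_tensorHom, ← kernel_comp, ← kernel_comp,
      h.hom_comul]⟩
  · intro h
    exact ⟨MarkovCategory.discard_natural p, kernel_injective <| by
      rw [kernel_comp, kernel_comp, kernel_tensorHom]; exact h.parallelComp_self_comp_copy'.symm⟩

theorem kernel_comp_ofMap (k : Z ⟶ A) (f : A.Pt → X.Pt) (hf : Measurable f) :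
    kernel (k ≫ ofMap f hf) = (kernel k).map f := by
  rw [kernel_comp, kernel_ofMap, Kernel.deterministic_comp_eq_map]

theorem ofMap_comp_ofMap (f : A.Pt → X.Pt) (hf : Measurable f) (g : X.Pt → Y.Pt)
    (hg : Measurable g) : ofMap f hf ≫ ofMap g hg = ofMap (g ∘ f) (hg.comp hf) :=
  kernel_injective (Kernel.deterministic_comp_deterministic hf hg)

/-! ### Almost sure equality and absolute continuity -/

open MarkovSupp

/-- The kernel `f(- | w, -)` obtained by fixing the first input of `f : W ⊗ X ⟶ Y` to be `w`. -/
noncomputable def slice (f : W ⊗ X ⟶ Y) (w : W.Pt) : Kernel X.Pt Y.Pt :=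
  Kernel.sectR (α := W.Pt) (β := X.Pt) (kernel f) w

instance (f : W ⊗ X ⟶ Y) (w : W.Pt) : IsMarkovKernel (slice f w) :=
  ⟨fun x => IsMarkovKernel.isProbabilityMeasure (κ := kernel f) (w, x)⟩

theorem slice_ofMap {f : (W ⊗ X).Pt → Y.Pt} (hf : Measurable f) (w : W.Pt) (x : X.Pt) :
    slice (ofMap f hf) w x = Measure.dirac (f (w, x)) := rfl

/-- Up to the order of the factors, `copyRun p f` is the joint law of `x ∼ p(-|a)` and
`y ∼ f(- | w, x)`. -/
theorem kernel_copyRun_apply (p : A ⟶ X) (f : W ⊗ X ⟶ Y) (w : W.Pt) (a : A.Pt) :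
    kernel (copyRun p f) (w, a) =
      (kernel p a ⊗ₘ slice f w).map Prod.swap := by
  have hp : kernel (W ◁ (p ≫ Δ[X])) (w, a) = (kernel p a).map (fun x => (w, x, x)) := by
    have h : (Kernel.copy X.Pt ∘ₖ kernel p) a = (kernel p a).map (fun x => (x, x)) := by
      rw [Kernel.copy, Kernel.deterministic_comp_eq_map, Kernel.map_apply _ (by fun_prop)]
      rfl
    rw [kernel_whiskerLeft, kernel_comp, kernel_copy]
    have : IsSFiniteKernel (Kernel.copy X.Pt ∘ₖ kernel p) := by
      have : IsMarkovKernel (Kernel.copy X.Pt) := by unfold Kernel.copy; infer_instance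
      exact inferInstance
    refine (Kernel.parallelComp_apply _ _ _).trans ?_
    rw [Kernel.id_apply, h, Measure.dirac_prod,
      Measure.map_map (by fun_prop) (by fun_prop)]
    rfl
  ext s hs
  have hs' : MeasurableSet (Prod.swap ⁻¹' s : Set (X.Pt × Y.Pt)) := measurable_swap hs
  have hcomp : kernel (copyRun p f) (w, a) =
      (kernel (W ◁ (p ≫ Δ[X])) (w, a)).bind (kernel ((α_ W X X).inv ≫ f ▷ X)) := rfl
  rw [Measure.map_apply measurable_swap hs, Measure.compProd_apply hs', hcomp, hp,
    Measure.bind_apply hs (Kernel.aemeasurable _),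
    lintegral_map (Kernel.measurable_coe _ hs) (by fun_prop)]
  refine lintegral_congr fun x => ?_
  rw [kernel_comp, kernel_associator_inv, Kernel.comp_deterministic_eq_comap, Kernel.comap_apply,
    kernel_whiskerRight]
  refine (congrArg (fun μ : Measure (Y.Pt × X.Pt) => μ s)
    (Kernel.parallelComp_apply (kernel f) Kernel.id ((w, x), x))).trans ?_
  dsimp only
  rw [Kernel.id_apply, Measure.prod_dirac, Measure.map_apply (by fun_prop) hs]
  rfl

theorem asEq_iff (p : A ⟶ X) (f g : W ⊗ X ⟶ Y) :
    ASEq p f g ↔ ∀ w a, ∀ᵐ x ∂kernel p a, slice f w x = slice g w x := by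
  have key (w a) : kernel (copyRun p f) (w, a) = kernel (copyRun p g) (w, a) ↔
      ∀ᵐ x ∂kernel p a, slice f w x = slice g w x := by
    rw [kernel_copyRun_apply, kernel_copyRun_apply]
    exact (MeasurableEquiv.map_measurableEquiv_injective
      (MeasurableEquiv.prodComm (α := X.Pt) (β := Y.Pt))).eq_iff.trans Kernel.compProd_eq_iff
  rw [ASEq, ← kernel_injective.eq_iff, DFunLike.ext_iff]
  exact ⟨fun h w a => (key w a).1 (h (w, a)), fun h x => (key x.1 x.2).2 (h x.1 x.2)⟩

/-- Absolute continuity means that every common null set of the measures `q(-|b)` is a null set of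
all the measures `p(-|a)`. The inputs `W` need no attention because almost sure equality is tested
on each slice separately. -/
theorem absCont_iff (p : A ⟶ X) (q : B ⟶ X) :
    AbsCont p q ↔
      ∀ N : Set X.Pt, MeasurableSet N → (∀ b, kernel q b N = 0) → ∀ a, kernel p a N = 0 := by
  classical
  constructor
  · intro h N hN hq a
    -- `N` is the set where the indicator of `N` differs from the constant `false`
    let T : BorelStoch.{u} := of (ULift.{u} Bool)
    have hf : Measurable fun z : (𝟙_ BorelStoch.{u} ⊗ X).Pt =>
        (⟨decide (z.2 ∈ N)⟩ : T.Pt) := by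
      have : Measurable fun x : X.Pt => (⟨decide (x ∈ N)⟩ : ULift.{u} Bool) :=
        measurable_up.comp (measurable_to_bool (by
          convert hN using 1
          ext x
          simp))
      exact this.comp measurable_snd
    have hg : Measurable fun _ : (𝟙_ BorelStoch.{u} ⊗ X).Pt => (⟨false⟩ : T.Pt) :=
      measurable_const
    have hne (w : (𝟙_ BorelStoch.{u}).Pt) (x : X.Pt) :
        slice (W := 𝟙_ BorelStoch.{u}) (Y := T) (ofMap _ hf) w x =
          slice (W := 𝟙_ BorelStoch.{u}) (Y := T) (ofMap _ hg) w x ↔ x ∉ N := by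
      rw [slice_ofMap, slice_ofMap, dirac_eq_dirac_iff]
      exact ULift.down_inj.symm.trans decide_eq_false_iff_not
    have hp := (asEq_iff p _ _).1 (h (W := 𝟙_ BorelStoch.{u}) (Y := T) (ofMap _ hf) (ofMap _ hg)
      ((asEq_iff q _ _).2 fun w b => by
        simp_rw [hne w]
        exact measure_eq_zero_iff_ae_notMem.1 (hq b))) PUnit.unit a
    simp_rw [hne PUnit.unit] at hp
    exact measure_eq_zero_iff_ae_notMem.2 hp
  · intro h W Y f g hfg
    rw [asEq_iff] at hfg ⊢
    intro w a
    have hN : MeasurableSet {x : X.Pt | slice f w x ≠ slice g w x} :=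
      (measurableSet_eq_kernel (slice f w) (slice g w)).compl
    exact h _ hN (fun b => hfg w b) a

/-! ### Atoms and atomic morphisms -/

theorem measurableSet_apply_singleton_pos (p : A ⟶ X) :
    MeasurableSet {z : A.Pt × X.Pt | 0 < kernel p z.1 {z.2}} := by
  have hD : MeasurableSet {z : (A.Pt × X.Pt) × X.Pt | z.2 = z.1.2} :=
    measurableSet_eq_fun measurable_snd measurable_fst.snd
  have h := Kernel.measurable_kernel_prodMk_left
    (κ := Kernel.prodMkRight X.Pt (kernel p)) hD
  exact measurableSet_lt measurable_const h

/-- The set of atoms is the projection of a Borel subset of `A × X`, hence analytic. -/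
theorem isUniversallyMeasurable_atoms (p : A ⟶ X) : IsUniversallyMeasurable (atoms p) := by
  intro μ _
  let _ := upgradeStandardBorel X.Pt
  have h : atoms p = Prod.snd '' {z : A.Pt × X.Pt | 0 < kernel p z.1 {z.2}} := by
    ext x
    simp [atoms]
  rw [h]
  exact ((measurableSet_apply_singleton_pos p).analyticSet_image measurable_snd).nullMeasurableSet μ

theorem isAtomic_iff (p : A ⟶ X) :
    IsAtomic p ↔ ∀ N : Set (X.Pt × X.Pt), MeasurableSet N →
      (∀ a a', ((kernel p a).prod (kernel p a')) N = 0) →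
      ∀ a, kernel p a {x | (x, x) ∈ N} = 0 := by
  have hdiag (a : A.Pt) {N : Set (X.Pt × X.Pt)} (hN : MeasurableSet N) :
      kernel (p ≫ Δ[X]) a N = kernel p a {x | (x, x) ∈ N} := by
    rw [kernel_comp, kernel_copy, Kernel.copy, Kernel.deterministic_comp_eq_map,
      Kernel.map_apply' _ (by fun_prop) _ hN]
    rfl
  have hprod (z : A.Pt × A.Pt) (N : Set (X.Pt × X.Pt)) :
      kernel (p ⊗ₘ p) z N = ((kernel p z.1).prod (kernel p z.2)) N := by
    rw [kernel_tensorHom, Kernel.parallelComp_apply]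
  rw [MarkovSupp.IsAtomic, absCont_iff]
  refine forall₂_congr fun N hN => imp_congr ?_ (forall_congr' fun a => by rw [hdiag a hN])
  exact ⟨fun h a a' => (hprod (a, a') N).symm.trans (h (a, a')),
    fun h z => (hprod z N).trans (h z.1 z.2)⟩

theorem isAtomic_iff_apply_atoms (p : A ⟶ X) :
    IsAtomic p ↔ ∀ a, kernel p a (atoms p) = 1 := by
  rw [isAtomic_iff]
  constructor
  · intro h a
    have hnull := isUniversallyMeasurable_atoms p (kernel p a)
    rw [← prob_compl_eq_zero_iff₀ hnull]
    obtain ⟨B, hB, hBm, hBae⟩ := hnull.compl.exists_measurable_subset_ae_eq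
    rw [← measure_congr hBae]
    -- no point of `B` is an atom, so that the diagonal of `B` is null for all product measures
    have hN : MeasurableSet {z : X.Pt × X.Pt | z.2 = z.1 ∧ z.1 ∈ B} :=
      (measurableSet_eq_fun measurable_snd measurable_fst).inter (measurable_fst hBm)
    have := h _ hN (fun a₁ a₂ => by
      rw [Measure.measure_prod_null hN]
      refine Filter.Eventually.of_forall fun x => ?_
      by_cases hx : x ∈ B
      · have hsing : Prod.mk x ⁻¹' {z : X.Pt × X.Pt | z.2 = z.1 ∧ z.1 ∈ B} = {x} := by
          ext y
          simp [hx]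
        refine (congrArg (kernel p a₂) hsing).trans ?_
        by_contra h0
        exact hB hx ⟨a₂, pos_iff_ne_zero.2 h0⟩
      · simp [hx]) a
    simpa using this
  · intro h N hN hnull a
    -- an atom on the diagonal of `N` would be charged by one of the product measures
    have hsub : {x | (x, x) ∈ N} ⊆ (atoms p)ᶜ := by
      rintro x hx ⟨a', ha'⟩
      have hxx : ((kernel p a').prod (kernel p a')) ({x} ×ˢ {x}) = 0 := by
        refine measure_mono_null ?_ (hnull a' a')
        rw [Set.singleton_prod_singleton]
        exact Set.singleton_subset_iff.2 hx
      rw [Measure.prod_prod] at hxx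
      exact ha'.ne' (mul_self_eq_zero.1 hxx)
    refine measure_mono_null hsub ?_
    rw [prob_compl_eq_zero_iff₀ (isUniversallyMeasurable_atoms p (kernel p a))]
    exact h a

theorem atoms_subset (p : A ⟶ X) {T : Set X.Pt} (hT : MeasurableSet T)
    (h : ∀ a, kernel p a T = 1) : atoms p ⊆ T := by
  rintro x ⟨a, ha⟩
  by_contra hx
  refine ha.ne' (measure_mono_null (Set.singleton_subset_iff.2 hx : {x} ⊆ Tᶜ) ?_)
  exact (prob_compl_eq_zero_iff hT).2 (h a)

/-- A smallest full set consists of atoms: removing from it a point that is not an atom would leave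
a smaller full set. -/
theorem atoms_eq_of_isLeast {p : A ⟶ X} {S : Set X.Pt}
    (hS : IsLeast {T : Set X.Pt | MeasurableSet T ∧ ∀ a, kernel p a T = 1} S) :
    atoms p = S := by
  refine (atoms_subset p hS.1.1 hS.1.2).antisymm fun x hx => ?_
  by_contra hxp
  have hx0 (a : A.Pt) : kernel p a {x} = 0 := by
    by_contra h0
    exact hxp ⟨a, pos_iff_ne_zero.2 h0⟩
  exact (hS.2 ⟨hS.1.1.diff (measurableSet_singleton x), fun a => by
    rw [measure_sdiff_null (hx0 a), hS.1.2 a]⟩ hx).2 rfl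

/-- If there is a smallest full set, then it is the set of atoms. -/
theorem hasSmallestFullSet_iff (p : A ⟶ X) :
    HasSmallestFullSet p ↔ MeasurableSet (atoms p) ∧ IsAtomic p := by
  rw [isAtomic_iff_apply_atoms]
  constructor
  · rintro ⟨S, hS⟩
    rw [atoms_eq_of_isLeast hS]
    exact hS.1
  · exact fun h => ⟨atoms p, h, fun T hT => atoms_subset p hT.1 hT.2⟩

theorem countable_setOf_apply_singleton_pos (p : A ⟶ X) (a : A.Pt) :
    {x | 0 < kernel p a {x}}.Countable :=
  Measure.countable_meas_pos_of_disjoint_iUnion measurableSet_singleton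
    fun _ _ h => Set.disjoint_singleton.2 h

theorem measurableSet_atoms_of_countable [Countable A.Pt] (p : A ⟶ X) :
    MeasurableSet (atoms p) := by
  have h : atoms p = ⋃ a, {x | 0 < kernel p a {x}} := by
    ext x
    simp [atoms]
  rw [h]
  exact (Set.countable_iUnion (countable_setOf_apply_singleton_pos p)).measurableSet

theorem atoms_ofMap (f : A.Pt → X.Pt) (hf : Measurable f) : atoms (ofMap f hf) = Set.range f := by
  ext x
  refine exists_congr fun a => ?_
  rw [kernel_ofMap, Kernel.deterministic_apply,
    Measure.dirac_apply' _ (measurableSet_singleton x)]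
  by_cases h : f a = x <;> simp [h]

/-- Although the range of `f` need not be measurable, it has `δ_{f a}`-outer measure one. -/
theorem isAtomic_ofMap (f : A.Pt → X.Pt) (hf : Measurable f) : IsAtomic (ofMap f hf) := by
  rw [isAtomic_iff_apply_atoms, atoms_ofMap]
  intro a
  rw [kernel_ofMap, Kernel.deterministic_apply]
  exact Measure.dirac_apply_of_mem (Set.mem_range_self a)

theorem not_hasSmallestFullSet_ofMap (f : A.Pt → X.Pt) (hf : Measurable f)
    (hr : ¬ MeasurableSet (Set.range f)) : ¬ HasSmallestFullSet (ofMap f hf) := by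
  rw [hasSmallestFullSet_iff, atoms_ofMap]
  exact fun h => hr h.1

/-! ### Supports -/

theorem absCont_iff_of_isLeast {p : A ⟶ X} {S : Set X.Pt}
    (hS : IsLeast {T : Set X.Pt | MeasurableSet T ∧ ∀ a, kernel p a T = 1} S) (f : Z ⟶ X) :
    AbsCont f p ↔ ∀ z, kernel f z S = 1 := by
  rw [absCont_iff]
  constructor
  · intro h z
    rw [← prob_compl_eq_zero_iff hS.1.1]
    exact h _ hS.1.1.compl (fun a => (prob_compl_eq_zero_iff hS.1.1).2 (hS.1.2 a)) z
  · intro h N hN hp z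
    have hsub : S ⊆ Nᶜ := hS.2 ⟨hN.compl, fun a => (prob_compl_eq_one_iff hN).2 (hp a)⟩
    refine measure_mono_null (Set.subset_compl_comm.1 hsub) ?_
    exact (prob_compl_eq_zero_iff hS.1.1).2 (h z)

/-- The smallest full set of `p`, with its inclusion into `X`, is a support of `p`. A kernel `f`
with `f ≪ p` is concentrated on that set, and restricts to it. -/
noncomputable def supportOfIsLeast {p : A ⟶ X} {S : Set X.Pt}
    (hS : IsLeast {T : Set X.Pt | MeasurableSet T ∧ ∀ a, kernel p a T = 1} S) : Support p :=
  haveI : StandardBorelSpace S := hS.1.1.standardBorel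
  have hemb : MeasurableEmbedding (Subtype.val : S → X.Pt) := .subtype_coe hS.1.1
  let i : of S ⟶ X := ofMap (A := of S) (X := X) Subtype.val measurable_subtype_coe
  have hrange {Z : BorelStoch.{u}} (f : Z ⟶ X) (hf : AbsCont f p) (z : Z.Pt) :
      kernel f z (Set.range (Subtype.val : S → X.Pt)) = 1 := by
    rw [Subtype.range_coe]
    exact (absCont_iff_of_isLeast hS f).1 hf z
  { S := of S
    homEquiv := fun Z =>
      { toFun := fun k => ⟨k ≫ i, by
          rw [absCont_iff_of_isLeast hS]
          intro z
          rw [kernel_comp_ofMap, Kernel.map_apply' _ measurable_subtype_coe _ hS.1.1,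
            Subtype.coe_preimage_self]
          exact ((isMarkovKernel_kernel k).isProbabilityMeasure z).measure_univ⟩
        invFun := fun f =>
          haveI := Kernel.IsMarkovKernel.comapRight (kernel f.1) hemb (hrange f.1 f.2)
          ofKernel (X := of S) (Kernel.comapRight (kernel f.1) hemb)
        left_inv := fun k => kernel_injective <| by
          ext z s hs
          rw [kernel_ofKernel, Kernel.comapRight_apply' _ _ _ hs, kernel_comp_ofMap,
            Kernel.map_apply' _ measurable_subtype_coe _ (hemb.measurableSet_image' hs),
            Set.preimage_image_eq _ Subtype.val_injective]
        right_inv := fun f => Subtype.ext <| kernel_injective <| by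
          ext z s hs
          rw [kernel_comp_ofMap, Kernel.map_apply' _ measurable_subtype_coe _ hs, kernel_ofKernel,
            Kernel.comapRight_apply' _ _ _ (measurable_subtype_coe hs),
            Set.image_preimage_eq_inter_range]
          exact measure_inter_conull ((prob_compl_eq_zero_iff hemb.measurableSet_range).2
            (hrange f.1 f.2 z)) }
    naturality := fun h k => Category.assoc h k i
    deterministic_iff := fun {Z} k => by
      change Deterministic k ↔ Deterministic (k ≫ i)
      rw [deterministic_iff, deterministic_iff, kernel_comp_ofMap]
      have : IsMarkovKernel (β := S) (kernel k) := isMarkovKernel_kernel k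
      exact (isDeterministic_map_iff hemb (kernel k)).symm }

/-- The morphism `S ⟶ X` corresponding to the identity of a support `S` is an injective measurable
map, and its range is the smallest full set. -/
theorem hasSmallestFullSet_of_support {p : A ⟶ X} (σ : Support p) : HasSmallestFullSet p := by
  -- the identity of the support corresponds to a deterministic morphism, that is, to a map `j`
  set i := (σ.homEquiv σ.S (𝟙 σ.S)).1 with hi
  have hfac {Z : BorelStoch.{u}} (k : Z ⟶ σ.S) : (σ.homEquiv Z k).1 = k ≫ i := by
    rw [hi, ← σ.naturality, Category.comp_id]
  have hdet : IsDeterministic (kernel i) :=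
    (deterministic_iff i).1 ((σ.deterministic_iff (𝟙 σ.S)).1 inferInstance)
  obtain ⟨j, hj, hij⟩ := Kernel.IsDeterministic.exists_eq_deterministic (kernel i)
  have hij : i = ofMap j hj := kernel_injective hij
  -- points of the support are determined by their images in `X`
  have hinj : Function.Injective j := by
    intro s t hst
    have hpt (s : σ.S.Pt) : (σ.homEquiv (𝟙_ BorelStoch.{u})
        (ofMap (A := 𝟙_ BorelStoch.{u}) (fun _ => s) measurable_const)).1 =
          ofMap (A := 𝟙_ BorelStoch.{u}) (fun _ => j s) measurable_const := by
      rw [hfac, hij, ofMap_comp_ofMap]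
      rfl
    have h := (σ.homEquiv _).injective (Subtype.ext ((hpt s).trans (hst ▸ (hpt t).symm)))
    have h' := DFunLike.congr_fun (congrArg kernel h) PUnit.unit
    exact dirac_eq_dirac_iff.1 h'
  have hm : MeasurableSet (Set.range j) := (hj.measurableEmbedding hinj).measurableSet_range
  refine ⟨Set.range j, ⟨hm, fun a => ?_⟩, fun T hT => ?_⟩
  · obtain ⟨k, hk⟩ := (σ.homEquiv A).surjective ⟨p, fun _ _ _ _ h => h⟩
    have hkp : k ≫ ofMap j hj = p := by rw [← hij, ← hfac, hk]
    have hpa : kernel p a (Set.range j) = kernel (k ≫ ofMap j hj) a (Set.range j) := by rw [hkp]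
    rw [hpa, kernel_comp_ofMap, Kernel.map_apply' _ hj _ hm, Set.preimage_range]
    exact measure_univ
  · rintro _ ⟨s, rfl⟩
    by_contra hs
    have h := (absCont_iff i p).1 (σ.homEquiv σ.S (𝟙 σ.S)).2 Tᶜ hT.1.compl
      (fun a => (prob_compl_eq_zero_iff hT.1).2 (hT.2 a)) s
    rw [hij, kernel_ofMap, Kernel.deterministic_apply,
      Measure.dirac_apply_of_mem (Set.mem_compl hs)] at h
    exact one_ne_zero h

theorem hasSupport_iff (p : A ⟶ X) : HasSupport p ↔ HasSmallestFullSet p :=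
  ⟨fun ⟨σ⟩ => hasSmallestFullSet_of_support σ, fun ⟨_, hS⟩ => ⟨supportOfIsLeast hS⟩⟩

end BorelStoch

theorem mainTheorem4 :
    (∀ {A X : BorelStoch.{u}} (p : A ⟶ X),
      -- the set of atoms of a Markov kernel is universally measurable
      IsUniversallyMeasurable (BorelStoch.atoms p) ∧
      (MarkovSupp.HasSupport p ↔ BorelStoch.HasSmallestFullSet p) ∧
      (BorelStoch.HasSmallestFullSet p → MarkovSupp.IsAtomic p) ∧
      (MarkovSupp.IsAtomic p ↔ ∀ a, BorelStoch.kernel p a (BorelStoch.atoms p) = 1) ∧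
      (Countable A.Pt → MarkovSupp.IsAtomic p → BorelStoch.HasSmallestFullSet p)) ∧
    -- measurable maps with non-measurable image are counterexamples to the converse
    (∀ {A X : BorelStoch.{u}} (f : A.Pt → X.Pt) (hf : Measurable f),
      ¬ MeasurableSet (Set.range f) →
      MarkovSupp.IsAtomic (BorelStoch.ofMap f hf) ∧
        ¬ BorelStoch.HasSmallestFullSet (BorelStoch.ofMap f hf)) ∧
    -- and there are such maps, already from the real line to itself
    (∃ (f : ℝ → ℝ) (hf : Measurable f), ¬ MeasurableSet (Set.range f) ∧
      MarkovSupp.IsAtomic (BorelStoch.ofMap (A := .of ℝ) (X := .of ℝ) f hf) ∧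
      ¬ BorelStoch.HasSmallestFullSet
        (BorelStoch.ofMap (A := .of ℝ) (X := .of ℝ) f hf)) := by
  refine ⟨fun {A X} p => ⟨BorelStoch.isUniversallyMeasurable_atoms p, BorelStoch.hasSupport_iff p,
      fun h => ((BorelStoch.hasSmallestFullSet_iff p).1 h).2,
      BorelStoch.isAtomic_iff_apply_atoms p,
      fun _ h => (BorelStoch.hasSmallestFullSet_iff p).2
        ⟨BorelStoch.measurableSet_atoms_of_countable p, h⟩⟩,
    fun f hf hr => ⟨BorelStoch.isAtomic_ofMap f hf,
      BorelStoch.not_hasSmallestFullSet_ofMap f hf hr⟩, ?_⟩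
  obtain ⟨f, hf, hr⟩ := exists_measurable_range_not_measurableSet
  exact ⟨f, hf, hr, BorelStoch.isAtomic_ofMap (A := .of ℝ) (X := .of ℝ) f hf,
    BorelStoch.not_hasSmallestFullSet_ofMap (A := .of ℝ) (X := .of ℝ) f hf hr⟩
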